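/- A convex body of the $d$-dimensional Euclidean space $E^d$ is a bounded convex set with non-empty interior; $\mathcal K^d$ denotes the family of all convex bodies of $E^d$. A polytope is the convex hull of finitely many points. For $C\in\mathcal K^d$ put $$\delta_n(C)=\inf\Big\{\frac{\operatorname{diam}(P)}{\operatorname{diam}(C)} :\ P\supset C \text{ is a polytope with at most } n \text{ facets}\Big\},\qquad \Delta_n(\mathcal K^d)=\sup\{\delta_n(C) : C\in\mathcal K^d\}.$$ Then $\Delta_6(\mathcal K^3)\le 1.773$, $\Delta_8(\mathcal K^3)\le 1.529$, $\Delta_{10}(\mathcal K^3)\le 1.438$, $\Delta_{12}(\mathcal K^3)\le 1.2585$, $\Delta_{14}(\mathcal K^3)\le 1.2394$ and $\Delta_{16}(\mathcal K^3)\le 1.1999$. Moreover, $\Delta_{2d}(\mathcal K^d)\le\sqrt d$ for every integer $d\ge 2$, and $\Delta_{2d+2}(\mathcal K^d)\le\sqrt{d-\frac23}$ for every integer $d\ge 3$. -/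

import Mathlib

/-- A convex body: a bounded convex set with non-empty interior
(it need not be closed). -/
def IsConvexBody {d : ℕ} (C : Set (EuclideanSpace ℝ (Fin d))) : Prop :=
  Bornology.IsBounded C ∧ Convex ℝ C ∧ (interior C).Nonempty

/-- The family of all convex bodies of the `d`-dimensional Euclidean space. -/
def convexBodies (d : ℕ) : Set (Set (EuclideanSpace ℝ (Fin d))) :=
  {C | IsConvexBody C}

/-- A (convex) polytope: the convex hull of finitely many points. -/
def IsPolytope {d : ℕ} (P : Set (EuclideanSpace ℝ (Fin d))) : Prop :=
  ∃ S : Set (EuclideanSpace ℝ (Fin d)), S.Finite ∧ P = convexHull ℝ S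

/-- A facet of `P`: a non-empty (exposed) face whose dimension is one less than the dimension
of `P`. (All faces of a polytope are exposed.) -/
def IsFacet {d : ℕ} (P F : Set (EuclideanSpace ℝ (Fin d))) : Prop :=
  F.Nonempty ∧ IsExposed ℝ P F ∧
    Module.finrank ℝ (vectorSpan ℝ F) + 1 = Module.finrank ℝ (vectorSpan ℝ P)

/-- `δ_n(C)`: the infimum of `diam P / diam C` over the polytopes `P ⊇ C` with at most `n`
facets. It is taken in the extended reals, so that it is `⊤` if there is no such `P`. -/
noncomputable def polyDelta {d : ℕ} (n : ℕ) (C : Set (EuclideanSpace ℝ (Fin d))) : EReal :=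
  ⨅ P ∈ {P : Set (EuclideanSpace ℝ (Fin d)) |
      IsPolytope P ∧ C ⊆ P ∧ {F | IsFacet P F}.encard ≤ (n : ℕ∞)},
    ((Metric.diam P / Metric.diam C : ℝ) : EReal)

/-- `Δ_n(B)`: the supremum of `δ_n(C)` over the bodies `C` of the family `B`. -/
noncomputable def polyDeltaSup {d : ℕ} (n : ℕ) (B : Set (Set (EuclideanSpace ℝ (Fin d)))) :
    EReal :=
  ⨆ C ∈ B, polyDelta n C

/-! ### Polytopes as bounded intersections of half-spaces -/

open scoped RealInnerProductSpace

/-! A body `C` of diameter `D` lies in a slab of width `D` orthogonal to any given direction. For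
`k` directions `u i`, the intersection `P` of these slabs has at most `2k` facets, and differences
of points of `P` lie in `D • Q`, where `Q` is the symmetric polytope `|⟪u i, x⟫| ≤ ‖u i‖`. Hence
`diam P / D` is at most the circumradius of `Q`, whatever `C` is
(`polyDeltaSup_le_of_abs_inner_le`), and only good directions remain to be found.

The axes make `Q` a cube, of circumradius `√d`; replacing a square factor by a regular hexagon
changes the squared circumradius to `4/3 + (d - 2)`. In dimension 3 these give the bounds for 6 and
8 facets. For 10 to 16 facets the directions are explicit integer vectors, and
`polyDeltaSup_three_le_of_verticesOK` reduces the circumradius bound to a finite integer check over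
candidate vertices. -/

theorem isPolytope_of_bounded_halfspaces {d : ℕ} {ι : Type*} [Finite ι]
    (v : ι → EuclideanSpace ℝ (Fin d)) (b : ι → ℝ)
    (hb : Bornology.IsBounded {x | ∀ i, ⟪v i, x⟫ ≤ b i}) :
    IsPolytope {x | ∀ i, ⟪v i, x⟫ ≤ b i} := by
  set P : Set (EuclideanSpace ℝ (Fin d)) := {x | ∀ i, ⟪v i, x⟫ ≤ b i} with hP
  have hPi : P = ⋂ i, {x | ⟪v i, x⟫ ≤ b i} := by ext; simp [hP]
  have hclosed : IsClosed P := by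
    rw [hPi]
    exact isClosed_iInter fun i ↦ isClosed_le (by fun_prop) continuous_const
  have hconv : Convex ℝ P := by
    rw [hPi]
    exact convex_iInter fun i ↦ convex_halfSpace_le (innerₛₗ ℝ (v i)).isLinear (b i)
  have hcomp : IsCompact P := Metric.isCompact_of_isClosed_isBounded hclosed hb
  -- An extreme point is determined by its active constraints: if `x` and `y` have the same ones,
  -- the segment from `y` to `x` can be prolonged inside `P` beyond `x`.
  have hinj : Set.InjOn (fun x ↦ {i | ⟪v i, x⟫ = b i}) (P.extremePoints ℝ) := by
    intro x hx y hy hxy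
    by_contra hne
    have hact : ∀ i, ⟪v i, x⟫ = b i ↔ ⟪v i, y⟫ = b i := fun i ↦ Set.ext_iff.mp hxy i
    have hev : ∀ᶠ t : ℝ in nhdsWithin 0 (Set.Ioi 0), ∀ i, ⟪v i, x - t • (y - x)⟫ ≤ b i := by
      refine Filter.eventually_all.2 fun i ↦ ?_
      by_cases hi : ⟪v i, x⟫ = b i
      · have hi' := (hact i).1 hi
        refine Filter.Eventually.of_forall fun t ↦ ?_
        simp only [inner_sub_right, inner_smul_right]
        simp [hi, hi']
      · have hlt : ⟪v i, x⟫ < b i := lt_of_le_of_ne (hx.1 i) hi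
        have hcont : Filter.Tendsto (fun t : ℝ ↦ ⟪v i, x - t • (y - x)⟫) (nhds 0)
            (nhds ⟪v i, x - (0 : ℝ) • (y - x)⟫) :=
          Continuous.tendsto (by fun_prop) 0
        have := hcont.eventually_lt_const (by simpa using hlt)
        exact (this.filter_mono nhdsWithin_le_nhds).mono fun t ht ↦ ht.le
    obtain ⟨t, ht, ht0⟩ := (hev.and self_mem_nhdsWithin).exists
    have ht0 : 0 < t := ht0
    have hseg : x ∈ openSegment ℝ (x - t • (y - x)) y := by
      refine ⟨1 / (1 + t), t / (1 + t), by positivity, by positivity, by field_simp, ?_⟩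
      have h1 : (1 + t) ≠ 0 := by positivity
      ext j
      simp
      field_simp
      ring
    have h := hx.2 ht hy.1 hseg
    have : t • (y - x) = 0 := by simpa using h
    rcases smul_eq_zero.1 this with h0 | h0
    · exact ht0.ne' h0
    · exact hne (sub_eq_zero.1 h0).symm
  have hfin : (P.extremePoints ℝ).Finite := Set.Finite.of_finite_image (Set.toFinite _) hinj
  refine ⟨P.extremePoints ℝ, hfin, ?_⟩
  conv_lhs => rw [← closure_convexHull_extremePoints hcomp hconv]
  exact (hfin.isCompact_convexHull ℝ).isClosed.closure_eq

/-- Some constraint is active on all of a facet. Otherwise averaging points of the facet gives one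
where all constraints are strict; the exposing functional has a local maximum there, so it vanishes
and the facet is all of `P`. -/
theorem encard_facets_halfspaces_le {d : ℕ} {ι : Type*} [Fintype ι]
    (v : ι → EuclideanSpace ℝ (Fin d)) (b : ι → ℝ) (hv : ∀ i, v i ≠ 0)
    (hint : (interior {x | ∀ i, ⟪v i, x⟫ ≤ b i}).Nonempty) :
    {F | IsFacet {x | ∀ i, ⟪v i, x⟫ ≤ b i} F}.encard ≤ (Fintype.card ι : ℕ∞) := by
  set P : Set (EuclideanSpace ℝ (Fin d)) := {x | ∀ i, ⟪v i, x⟫ ≤ b i} with hP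
  have hspan : vectorSpan ℝ P = ⊤ := by
    rw [← direction_affineSpan]
    have h := isOpen_interior.affineSpan_eq_top hint
    have : affineSpan ℝ P = ⊤ := top_le_iff.1 (h ▸ affineSpan_mono ℝ interior_subset)
    rw [this, AffineSubspace.direction_top]
  have key : {F | IsFacet P F} ⊆ Set.range fun i ↦ {x | x ∈ P ∧ ⟪v i, x⟫ = b i} := by
    rintro F ⟨hne, hexp, hrank⟩
    have hFconv : Convex ℝ F := hexp.convex (by
      have hPi : P = ⋂ i, {x | ⟪v i, x⟫ ≤ b i} := by ext; simp [hP]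
      rw [hPi]
      exact convex_iInter fun i ↦ convex_halfSpace_le (innerₛₗ ℝ (v i)).isLinear (b i))
    obtain ⟨l, hl⟩ := hexp hne
    have hFP : F ⊆ P := hexp.subset
    have hmax : ∀ z ∈ F, ∀ y ∈ P, l y ≤ l z := fun z hz ↦ by
      rw [hl] at hz
      exact hz.2
    obtain ⟨i, hi⟩ : ∃ i, ∀ x ∈ F, ⟪v i, x⟫ = b i := by
      by_contra! hcon
      have hstrict : ∀ s : Finset ι, ∃ z ∈ F, ∀ i ∈ s, ⟪v i, z⟫ < b i := by
        classical
        intro s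
        induction s using Finset.induction_on with
        | empty => exact hne.imp fun z hz ↦ ⟨hz, by simp⟩
        | insert i s _ ih =>
          obtain ⟨z, hz, hzs⟩ := ih
          obtain ⟨y, hy, hyi⟩ := hcon i
          refine ⟨(1 / 2 : ℝ) • z + (1 / 2 : ℝ) • y,
            hFconv hz hy (by norm_num) (by norm_num) (by norm_num), fun j hj ↦ ?_⟩
          rw [inner_add_right, inner_smul_right, inner_smul_right]
          have hzj := hFP hz j
          have hyj := hFP hy j
          rcases Finset.mem_insert.1 hj with rfl | hj
          · have := lt_of_le_of_ne hyj hyi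
            linarith
          · have := hzs j hj
            linarith
      obtain ⟨z, hz, hzlt⟩ := hstrict Finset.univ
      have hopen : IsOpen {x | ∀ i, ⟪v i, x⟫ < b i} := by
        have : {x | ∀ i, ⟪v i, x⟫ < b i} = ⋂ i, {x | ⟪v i, x⟫ < b i} := by ext; simp
        rw [this]
        exact isOpen_iInter_of_finite fun i ↦ isOpen_lt (by fun_prop) continuous_const
      have hloc : IsLocalMax l z := by
        filter_upwards [hopen.mem_nhds fun i ↦ hzlt i (Finset.mem_univ i)] with y hy
        exact hmax z hz y fun i ↦ (hy i).le
      have hl0 : l = 0 := by simpa using hloc.fderiv_eq_zero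
      have : F = P := by rw [hl]; simp [hl0]
      rw [this] at hrank
      omega
    have hle : vectorSpan ℝ F ≤ (ℝ ∙ v i)ᗮ := by
      refine Submodule.span_le.2 ?_
      rintro _ ⟨x, hx, y, hy, rfl⟩
      rw [SetLike.mem_coe, Submodule.mem_orthogonal_singleton_iff_inner_right]
      simp [inner_sub_right, hi x hx, hi y hy]
    -- By dimension, the facet spans the whole constraint hyperplane, so `l` is constant there and
    -- the facet is all of `P` within it.
    have heq : vectorSpan ℝ F = (ℝ ∙ v i)ᗮ := by
      refine Submodule.eq_of_le_of_finrank_eq hle ?_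
      have h1 := Submodule.finrank_add_finrank_orthogonal (ℝ ∙ v i)
      rw [finrank_span_singleton (hv i)] at h1
      rw [hspan, finrank_top] at hrank
      omega
    have hker : vectorSpan ℝ F ≤ LinearMap.ker (l : EuclideanSpace ℝ (Fin d) →ₗ[ℝ] ℝ) := by
      refine Submodule.span_le.2 ?_
      rintro _ ⟨x, hx, y, hy, rfl⟩
      simp [le_antisymm (hmax y hy x (hFP hx)) (hmax x hx y (hFP hy))]
    refine ⟨i, Set.Subset.antisymm ?_ fun x hx ↦ ⟨hFP hx, hi x hx⟩⟩
    rintro x ⟨hxP, hxi⟩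
    obtain ⟨y, hy⟩ := hne
    have hmem : x - y ∈ (ℝ ∙ v i)ᗮ := by
      rw [Submodule.mem_orthogonal_singleton_iff_inner_right]
      simp [inner_sub_right, hi y hy, hxi]
    have hlxy : l x = l y := by
      have := hker (heq ▸ hmem)
      simpa [sub_eq_zero] using this
    rw [hl]
    exact ⟨hxP, fun w hw ↦ hlxy ▸ hmax y hy w hw⟩
  refine (Set.encard_le_encard key).trans ?_
  rw [← Set.image_univ]
  refine (Set.encard_image_le _ _).trans ?_
  rw [Set.encard_univ, ENat.card_eq_coe_fintype_card]

/-! ### Reduction to the circumradius of a symmetric polytope -/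

theorem polyDeltaSup_le_of_abs_inner_le {d : ℕ} (hd : 0 < d) {ι : Type*} [Fintype ι]
    (u : ι → EuclideanSpace ℝ (Fin d)) (hu : ∀ i, u i ≠ 0) {m : ℕ}
    (hm : 2 * Fintype.card ι ≤ m) {R : ℝ} (hR : ∀ x, (∀ i, |⟪u i, x⟫| ≤ ‖u i‖) → ‖x‖ ≤ R) :
    polyDeltaSup m (convexBodies d) ≤ (R : EReal) := by
  have hR0 : 0 ≤ R := by simpa using hR 0 (by simp)
  refine iSup₂_le fun C hC ↦ ?_
  obtain ⟨hCb, -, hCi⟩ := hC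
  have : Nonempty (Fin d) := ⟨⟨0, hd⟩⟩
  obtain ⟨x₀, hx₀⟩ := hCi.mono interior_subset
  have hD : 0 < Metric.diam C := by
    obtain ⟨c, hc⟩ := hCi
    obtain ⟨r, hr, hball⟩ := Metric.isOpen_iff.1 isOpen_interior c hc
    have hsub := hball.trans interior_subset
    obtain ⟨w, hw⟩ := exists_norm_eq (EuclideanSpace ℝ (Fin d)) (half_pos hr).le
    have h := Metric.dist_le_diam_of_mem hCb (hsub (Metric.mem_ball_self hr))
      (hsub (show c + w ∈ Metric.ball c r by simp [hw, hr]))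
    rw [dist_self_add_right, hw] at h
    linarith
  set D := Metric.diam C with hDdef
  -- The slab starts at the infimum over `C` and is given the full width `D`, even where `C` is
  -- narrower.
  set a : ι → ℝ := fun i ↦ sInf ((fun x ↦ ⟪u i, x⟫) '' C) with ha
  have hbdd : ∀ i, BddBelow ((fun x ↦ ⟪u i, x⟫) '' C) := fun i ↦
    ((innerSL ℝ (u i)).lipschitz.isBounded_image hCb).bddBelow
  have hlow : ∀ i, ∀ x ∈ C, a i ≤ ⟪u i, x⟫ := fun i x hx ↦
    csInf_le (hbdd i) ⟨x, hx, rfl⟩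
  have hupp : ∀ i, ∀ x ∈ C, ⟪u i, x⟫ ≤ a i + D * ‖u i‖ := by
    intro i x hx
    rw [← sub_le_iff_le_add]
    refine le_csInf ⟨_, x₀, hx₀, rfl⟩ ?_
    rintro _ ⟨y, hy, rfl⟩
    have h1 := real_inner_le_norm (u i) (x - y)
    have h2 := Metric.dist_le_diam_of_mem hCb hx hy
    rw [dist_eq_norm] at h2
    have h3 := mul_le_mul_of_nonneg_left h2 (norm_nonneg (u i))
    rw [inner_sub_right] at h1
    simp only
    linarith
  let v : ι ⊕ ι → EuclideanSpace ℝ (Fin d) := Sum.elim u (fun i ↦ -u i)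
  let b : ι ⊕ ι → ℝ := Sum.elim (fun i ↦ a i + D * ‖u i‖) (fun i ↦ -a i)
  set P : Set (EuclideanSpace ℝ (Fin d)) := {x | ∀ i, ⟪v i, x⟫ ≤ b i} with hP
  have hmem : ∀ x, x ∈ P ↔ ∀ i, a i ≤ ⟪u i, x⟫ ∧ ⟪u i, x⟫ ≤ a i + D * ‖u i‖ := fun x ↦ by
    simp [hP, v, b, Sum.forall, forall_and, and_comm]
  have hCP : C ⊆ P := fun x hx ↦ (hmem x).2 fun i ↦ ⟨hlow i x hx, hupp i x hx⟩
  have hdist : ∀ x ∈ P, ∀ y ∈ P, dist x y ≤ R * D := by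
    intro x hx y hy
    have h := hR (D⁻¹ • (x - y)) fun i ↦ by
      have h1 := (hmem x).1 hx i
      have h2 := (hmem y).1 hy i
      rw [inner_smul_right, inner_sub_right, abs_mul, abs_of_pos (inv_pos.2 hD),
        inv_mul_le_iff₀ hD, abs_le]
      constructor <;> linarith [h1.1, h1.2, h2.1, h2.2]
    rw [norm_smul, norm_inv, Real.norm_of_nonneg hD.le, inv_mul_le_iff₀ hD] at h
    rw [dist_eq_norm]
    linarith
  have hPb : Bornology.IsBounded P := Metric.isBounded_iff.2 ⟨R * D, fun x hx y hy ↦ hdist x hx y hy⟩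
  have hfacets : {F | IsFacet P F}.encard ≤ (m : ℕ∞) := by
    refine (encard_facets_halfspaces_le v b ?_ (hCi.mono (interior_mono hCP))).trans ?_
    · rintro (i | i) <;> simp [v, hu]
    · rw [Fintype.card_sum]
      exact_mod_cast (by omega)
  refine (iInf₂_le P ⟨isPolytope_of_bounded_halfspaces v b hPb, hCP, hfacets⟩).trans ?_
  rw [EReal.coe_le_coe_iff, div_le_iff₀ hD]
  exact Metric.diam_le_of_forall_dist_le (by positivity) hdist

/-! ### Cube and hexagonal prism -/

theorem polyDeltaSup_two_mul_le_sqrt {d : ℕ} (hd : 0 < d) :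
    polyDeltaSup (2 * d) (convexBodies d) ≤ ((Real.sqrt (d : ℝ) : ℝ) : EReal) := by
  refine polyDeltaSup_le_of_abs_inner_le hd (fun i : Fin d ↦ EuclideanSpace.single i (1 : ℝ))
    (by simp) (by simp) fun x hx ↦ ?_
  refine Real.le_sqrt_of_sq_le ?_
  rw [EuclideanSpace.real_norm_sq_eq]
  have h : ∀ i ∈ Finset.univ, x i ^ 2 ≤ 1 := fun i _ ↦ by
    have := hx i
    simp only [EuclideanSpace.inner_single_left, PiLp.norm_single] at this
    rw [sq_le_one_iff_abs_le_one]
    simpa using this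
  simpa using Finset.sum_le_sum h

theorem sq_add_sq_le_of_mem_hexagon {x y : ℝ} (h₀ : |x| ≤ 1) (h₁ : |x + √3 * y| ≤ 2)
    (h₂ : |x - √3 * y| ≤ 2) : x ^ 2 + y ^ 2 ≤ 4 / 3 := by
  have h3 : (√3 * y) ^ 2 = 3 * y ^ 2 := by rw [mul_pow]; norm_num
  generalize √3 * y = s at *
  have hs : |s| ≤ 2 - |x| := by
    rw [abs_le] at *
    rcases abs_cases x with h | h <;> rcases abs_cases s with h' | h' <;>
      constructor <;> linarith
  have hsq : s ^ 2 ≤ (2 - |x|) ^ 2 := by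
    rw [← sq_abs s]
    exact pow_le_pow_left₀ (abs_nonneg s) hs 2
  have := mul_nonneg (abs_nonneg x) (sub_nonneg.2 h₀)
  -- `3x² + (2 - |x|)² = 4 - 4|x|(1 - |x|)`.
  nlinarith [sq_abs x]

theorem polyDeltaSup_two_mul_add_two_le_sqrt {d : ℕ} (hd : 2 ≤ d) :
    polyDeltaSup (2 * d + 2) (convexBodies d) ≤ ((Real.sqrt ((d : ℝ) - 2 / 3) : ℝ) : EReal) := by
  obtain ⟨m, rfl⟩ := Nat.exists_eq_add_of_le' hd
  let e : Fin (m + 2) → EuclideanSpace ℝ (Fin (m + 2)) := fun i ↦ EuclideanSpace.single i 1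
  have he : ∀ i x, ⟪e i, x⟫ = x i := fun i x ↦ by simp [e, EuclideanSpace.inner_single_left]
  have hnorm : ∀ t : ℝ, ‖e 0 + t • e 1‖ ^ 2 = 1 + t ^ 2 := fun t ↦ by
    rw [norm_add_sq_real, norm_smul, inner_smul_right, he]
    simp [e]
  have hcard : 2 * Fintype.card (Fin 3 ⊕ Fin m) ≤ 2 * (m + 2) + 2 := by
    simp only [Fintype.card_sum, Fintype.card_fin]; omega
  have hsq3 : (√3) ^ 2 = 3 := by norm_num
  have hpos : ‖e 0 + √3 • e 1‖ = 2 := by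
    rw [← sq_eq_sq₀ (norm_nonneg _) (by norm_num), hnorm, hsq3]; norm_num
  have hneg : ‖e 0 + (-√3) • e 1‖ = 2 := by
    rw [← sq_eq_sq₀ (norm_nonneg _) (by norm_num), hnorm, neg_sq, hsq3]; norm_num
  refine polyDeltaSup_le_of_abs_inner_le (by omega)
    -- Three hexagon normals in the first coordinate plane and the other `m` axes.
    (Sum.elim ![e 0, e 0 + √3 • e 1, e 0 + (-√3) • e 1] fun j : Fin m ↦ e j.succ.succ)
    ?_ hcard fun x hx ↦ ?_
  · rintro (i | i)
    · rw [Sum.elim_inl, ← norm_pos_iff]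
      fin_cases i
      · simp [e]
      · simp [hpos]
      · simp only [Fin.reduceFinMk, Matrix.cons_val]
        rw [hneg]
        norm_num
    · simp [e]
  · have h0 := hx (Sum.inl 0)
    have h1 := hx (Sum.inl 1)
    have h2 := hx (Sum.inl 2)
    simp only [Sum.elim_inl, Matrix.cons_val, inner_add_left, inner_smul_left, he, hpos, hneg]
      at h0 h1 h2
    have hplane := sq_add_sq_le_of_mem_hexagon (x := x 0) (y := x 1) (by simpa [e] using h0)
      (by simpa using h1) (by simpa [sub_eq_add_neg] using h2)
    refine Real.le_sqrt_of_sq_le ?_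
    rw [EuclideanSpace.real_norm_sq_eq, Fin.sum_univ_succ, Fin.sum_univ_succ]
    have hrest : ∀ j ∈ (Finset.univ : Finset (Fin m)), x j.succ.succ ^ 2 ≤ 1 := fun j _ ↦ by
      have h := hx (Sum.inr j)
      rw [sq_le_one_iff_abs_le_one]
      simpa [he, e] using h
    have hsum := Finset.sum_le_sum hrest
    simp only [Finset.sum_const, Finset.card_univ, Fintype.card_fin, nsmul_eq_mul, mul_one] at hsum
    push_cast
    have h01 : x (Fin.succ 0) = x 1 := rfl
    rw [h01]
    linarith

/-! ### Farthest points and the integer vertex certificate -/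

theorem exists_norm_max_span_active_eq_top {d : ℕ} {ι : Type*} [Fintype ι]
    (u : ι → EuclideanSpace ℝ (Fin d)) (n : ι → ℝ) (hn : ∀ i, 0 ≤ n i)
    (hu : ∀ w, (∀ i, ⟪u i, w⟫ = 0) → w = 0) :
    ∃ z, (∀ i, |⟪u i, z⟫| ≤ n i) ∧ (∀ x, (∀ i, |⟪u i, x⟫| ≤ n i) → ‖x‖ ≤ ‖z‖) ∧
      Submodule.span ℝ (u '' {i | |⟪u i, z⟫| = n i}) = ⊤ := by
  set P : Set (EuclideanSpace ℝ (Fin d)) := {x | ∀ i, |⟪u i, x⟫| ≤ n i} with hP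
  have hortho : ∀ s : Set (EuclideanSpace ℝ (Fin d)), (∀ w, (∀ y ∈ s, ⟪y, w⟫ = 0) → w = 0) →
      Submodule.span ℝ s = ⊤ := by
    intro s hs
    rw [← Submodule.orthogonal_eq_bot_iff, eq_bot_iff]
    intro w hw
    rw [Submodule.mem_orthogonal] at hw
    exact hs w fun y hy ↦ hw y (Submodule.subset_span hy)
  let T : EuclideanSpace ℝ (Fin d) →ₗ[ℝ] (ι → ℝ) := LinearMap.pi fun i ↦ innerₛₗ ℝ (u i)
  have hT : LinearMap.ker T = ⊥ := by
    rw [eq_bot_iff]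
    intro w hw
    exact hu w fun i ↦ congrFun hw i
  obtain ⟨K, -, hK⟩ := T.exists_antilipschitzWith hT
  have hbdd : Bornology.IsBounded P := by
    refine (hK.isBounded_preimage (Metric.isBounded_Icc (fun i ↦ -n i) n)).subset fun x hx ↦ ?_
    exact ⟨fun i ↦ (abs_le.1 (hx i)).1, fun i ↦ (abs_le.1 (hx i)).2⟩
  have hclosed : IsClosed P := by
    have hPi : P = ⋂ i, {x | |⟪u i, x⟫| ≤ n i} := by ext; simp [hP]
    rw [hPi]
    exact isClosed_iInter fun i ↦ isClosed_le (by fun_prop) continuous_const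
  obtain ⟨z, hz, hmax⟩ := (Metric.isCompact_of_isClosed_isBounded hclosed hbdd).exists_isMaxOn
    ⟨0, fun i ↦ by simpa using hn i⟩ continuous_norm.continuousOn
  refine ⟨z, hz, fun x hx ↦ hmax hx, hortho _ fun w hw ↦ ?_⟩
  -- If `w` is orthogonal to all active normals, `z ± t • w` both stay feasible for small `t`; by
  -- the parallelogram law neither can fail to exceed `‖z‖` unless `w = 0`.
  have hev : ∀ᶠ t : ℝ in nhdsWithin 0 (Set.Ioi 0),
      (∀ i, |⟪u i, z + t • w⟫| ≤ n i) ∧ ∀ i, |⟪u i, z - t • w⟫| ≤ n i := by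
    rw [Filter.eventually_and, Filter.eventually_all, Filter.eventually_all, ← forall_and]
    intro i
    by_cases hi : |⟪u i, z⟫| = n i
    · have hwi := hw (u i) ⟨i, hi, rfl⟩
      constructor <;> refine Filter.Eventually.of_forall fun t ↦ ?_
      · simp [inner_add_right, inner_smul_right, hwi, hi.le]
      · simp [inner_sub_right, inner_smul_right, hwi, hi.le]
    · have hlt : |⟪u i, z⟫| < n i := lt_of_le_of_ne (hz i) hi
      have hc : ∀ y, ∀ᶠ t : ℝ in nhdsWithin 0 (Set.Ioi 0), |⟪u i, z + t • y⟫| ≤ n i := by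
        intro y
        have hcont : Filter.Tendsto (fun t : ℝ ↦ |⟪u i, z + t • y⟫|) (nhds 0)
            (nhds |⟪u i, z + (0 : ℝ) • y⟫|) := Continuous.tendsto (by fun_prop) 0
        exact ((hcont.eventually_lt_const (by simpa using hlt)).filter_mono
          nhdsWithin_le_nhds).mono fun t ht ↦ ht.le
      exact ⟨hc w, by simpa [sub_eq_add_neg] using hc (-w)⟩
  obtain ⟨t, ⟨ht1, ht2⟩, ht0⟩ := (hev.and self_mem_nhdsWithin).exists
  have ht0 : 0 < t := ht0
  have h1 : ‖z + t • w‖ ≤ ‖z‖ := hmax ht1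
  have h2 : ‖z - t • w‖ ≤ ‖z‖ := hmax ht2
  have hpar := parallelogram_law_with_norm ℝ z (t • w)
  have h0 : ‖t • w‖ = 0 := by
    nlinarith [norm_nonneg (z + t • w), norm_nonneg (z - t • w), norm_nonneg z,
      norm_nonneg (t • w), mul_self_le_mul_self (norm_nonneg _) h1,
      mul_self_le_mul_self (norm_nonneg _) h2]
  rw [norm_eq_zero, smul_eq_zero] at h0
  exact h0.resolve_left ht0.ne'

/-- The determinant of the matrix with rows `p a`, `p b`, `p c`. -/
def rowDet {k : ℕ} (x y z : Fin k → ℤ) (a b c : Fin k) : ℤ :=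
  x a * (y b * z c - z b * y c) - y a * (x b * z c - z b * x c) + z a * (x b * y c - y b * x c)

/-- One coordinate of the Cramer numerator for a `3 × 3` system with right-hand side `α, β, γ`. -/
def cramerNum {k : ℕ} (p q : Fin k → ℤ) (a b c : Fin k) (α β γ : ℤ) : ℤ :=
  α * (p b * q c - q b * p c) + β * (p c * q a - q c * p a) + γ * (p a * q b - q a * p b)

/-- The candidate vertex with numerator `w` and denominator `D` of the polytope `|⟨pᵢ, v⟩| ≤ nᵢ`
has squared norm at most `A / B`, or is degenerate, or violates one of the constraints. -/
def VertexOK {k : ℕ} (x y z n : Fin k → ℤ) (A B D w₀ w₁ w₂ : ℤ) : Prop :=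
  D = 0 ∨ B * (w₀ * w₀ + w₁ * w₁ + w₂ * w₂) ≤ A * (D * D) ∨
    ∃ j, n j * n j * (D * D) < (x j * w₀ + y j * w₁ + z j * w₂) ^ 2

instance {k : ℕ} (x y z n : Fin k → ℤ) (A B D w₀ w₁ w₂ : ℤ) :
    Decidable (VertexOK x y z n A B D w₀ w₁ w₂) :=
  inferInstanceAs (Decidable (_ ∨ _ ∨ _))

/-- Every candidate vertex of the polytope `|⟨pᵢ, v⟩| ≤ nᵢ` passes `VertexOK`. -/
def VerticesOK {k : ℕ} (x y z n : Fin k → ℤ) (A B : ℤ) : Prop :=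
  ∀ a b c : Fin k, ∀ α ∈ [n a, -n a], ∀ β ∈ [n b, -n b], ∀ γ ∈ [n c, -n c],
    VertexOK x y z n A B (rowDet x y z a b c) (cramerNum y z a b c α β γ)
      (cramerNum z x a b c α β γ) (cramerNum x y a b c α β γ)

instance {k : ℕ} (x y z n : Fin k → ℤ) (A B : ℤ) : Decidable (VerticesOK x y z n A B) :=
  inferInstanceAs (Decidable (∀ _, _))

theorem rowDet_mul_eq_cramerNum {k : ℕ} (x y z : Fin k → ℤ) (a b c : Fin k) {α β γ : ℤ}
    {v₀ v₁ v₂ : ℝ} (ha : x a * v₀ + y a * v₁ + z a * v₂ = α)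
    (hb : x b * v₀ + y b * v₁ + z b * v₂ = β) (hc : x c * v₀ + y c * v₁ + z c * v₂ = γ) :
    rowDet x y z a b c * v₀ = cramerNum y z a b c α β γ ∧
      rowDet x y z a b c * v₁ = cramerNum z x a b c α β γ ∧
      rowDet x y z a b c * v₂ = cramerNum x y a b c α β γ := by
  simp only [rowDet, cramerNum]
  push_cast
  rw [← ha, ← hb, ← hc]
  refine ⟨?_, ?_, ?_⟩ <;> ring

theorem exists_rowDet_ne_zero {k : ℕ} (x y z : Fin k → ℤ) (s : Set (Fin k))
    (hs : Submodule.span ℝ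
      ((fun i ↦ (!₂[(x i : ℝ), y i, z i] : EuclideanSpace ℝ (Fin 3))) '' s) = ⊤) :
    ∃ a ∈ s, ∃ b ∈ s, ∃ c ∈ s, rowDet x y z a b c ≠ 0 := by
  set S := (fun i ↦ (!₂[(x i : ℝ), y i, z i] : EuclideanSpace ℝ (Fin 3))) '' s
  have hf := Submodule.exists_fun_fin_finrank_span_eq ℝ S
  have hrank : Module.finrank ℝ (Submodule.span ℝ S) = 3 := by
    rw [hs, finrank_top, finrank_euclideanSpace_fin]
  rw [hrank] at hf
  obtain ⟨f, hfS, -, hli⟩ := hf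
  choose g hgs hg using hfS
  refine ⟨g 0, hgs 0, g 1, hgs 1, g 2, hgs 2, fun h ↦ ?_⟩
  have hli' := hli.map' (WithLp.linearEquiv 2 ℝ (Fin 3 → ℝ)).toLinearMap (LinearEquiv.ker _)
  have hunit := (Matrix.linearIndependent_rows_iff_isUnit
    (A := Matrix.of fun i j ↦ f i j)).1 hli'
  rw [Matrix.isUnit_iff_isUnit_det, isUnit_iff_ne_zero, Matrix.det_fin_three] at hunit
  apply hunit
  have h' : (rowDet x y z (g 0) (g 1) (g 2) : ℝ) = 0 := by exact_mod_cast h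
  simp only [rowDet] at h'
  push_cast at h'
  simp only [Matrix.of_apply, ← hg]
  simp
  linear_combination h'

/-- Replacing `‖u i‖` by the integer bound `n i` only enlarges the polytope. Its farthest point has
three independent active constraints, so Cramer's rule makes it one of the candidates tested by
`VerticesOK`; being feasible, it must satisfy the norm bound. -/
theorem polyDeltaSup_three_le_of_verticesOK {k m : ℕ} (hm : 2 * k ≤ m) (x y z n : Fin k → ℤ)
    {A B : ℤ} (hB : 0 < B) (hn : ∀ i, 0 < n i)
    (hp : ∀ i, 0 < x i ^ 2 + y i ^ 2 + z i ^ 2 ∧ x i ^ 2 + y i ^ 2 + z i ^ 2 ≤ n i ^ 2)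
    (hdet : ∃ a b c, rowDet x y z a b c ≠ 0) (hv : VerticesOK x y z n A B)
    {R : ℝ} (hR : 0 ≤ R) (hAB : (A : ℝ) ≤ B * R ^ 2) :
    polyDeltaSup m (convexBodies 3) ≤ (R : EReal) := by
  let u : Fin k → EuclideanSpace ℝ (Fin 3) := fun i ↦ !₂[(x i : ℝ), y i, z i]
  have hinner : ∀ i v, ⟪u i, v⟫ = x i * v 0 + y i * v 1 + z i * v 2 := fun i v ↦ by
    simp [u, PiLp.inner_apply, Fin.sum_univ_three, mul_comm]
  have hnorm : ∀ i, ‖u i‖ ^ 2 = ((x i ^ 2 + y i ^ 2 + z i ^ 2 : ℤ) : ℝ) := fun i ↦ by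
    rw [EuclideanSpace.real_norm_sq_eq, Fin.sum_univ_three]
    simp [u]
  have hle : ∀ i, ‖u i‖ ≤ n i := fun i ↦ by
    refine (sq_le_sq₀ (norm_nonneg _) (by exact_mod_cast (hn i).le)).1 ?_
    rw [hnorm]
    exact_mod_cast (hp i).2
  obtain ⟨v, hvP, hmax, hspan⟩ := exists_norm_max_span_active_eq_top u (fun i ↦ (n i : ℝ))
    (fun i ↦ by exact_mod_cast (hn i).le) fun w hw ↦ by
      obtain ⟨a, b, c, hD⟩ := hdet
      have hw' : ∀ i, x i * w 0 + y i * w 1 + z i * w 2 = ((0 : ℤ) : ℝ) := fun i ↦ by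
        rw [← hinner, hw, Int.cast_zero]
      have hD' : (rowDet x y z a b c : ℝ) ≠ 0 := by exact_mod_cast hD
      obtain ⟨h0, h1, h2⟩ := rowDet_mul_eq_cramerNum x y z a b c (hw' a) (hw' b) (hw' c)
      simp only [cramerNum, zero_mul, add_zero, Int.cast_zero, mul_eq_zero, hD', false_or]
        at h0 h1 h2
      ext i
      fin_cases i <;> simp [h0, h1, h2]
  refine polyDeltaSup_le_of_abs_inner_le (by norm_num) u (fun i h0 ↦ ?_) (by simpa using hm)
    fun w hw ↦ (hmax w fun i ↦ (hw i).trans (hle i)).trans ?_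
  · have h := hnorm i
    rw [h0, norm_zero] at h
    have : (0 : ℝ) < ((x i ^ 2 + y i ^ 2 + z i ^ 2 : ℤ) : ℝ) := by exact_mod_cast (hp i).1
    simp only [ne_eq, OfNat.ofNat_ne_zero, not_false_eq_true, zero_pow] at h
    exact this.ne h
  · obtain ⟨a, ha, b, hb, c, hc, hD⟩ := exists_rowDet_ne_zero x y z _ hspan
    have hsign : ∀ i, |⟪u i, v⟫| = n i → ∃ α ∈ [n i, -n i],
        x i * v 0 + y i * v 1 + z i * v 2 = (α : ℝ) := fun i hi ↦ by
      rw [hinner] at hi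
      rcases eq_or_eq_neg_of_abs_eq hi with h | h
      · exact ⟨n i, by simp, h⟩
      · exact ⟨-n i, by simp, by simpa using h⟩
    obtain ⟨α, hα, hα'⟩ := hsign a ha
    obtain ⟨β, hβ, hβ'⟩ := hsign b hb
    obtain ⟨γ, hγ, hγ'⟩ := hsign c hc
    obtain ⟨h0, h1, h2⟩ := rowDet_mul_eq_cramerNum x y z a b c hα' hβ' hγ'
    have hOK := hv a b c α hα β hβ γ hγ
    generalize rowDet x y z a b c = D at *
    generalize cramerNum y z a b c α β γ = w₀ at *
    generalize cramerNum z x a b c α β γ = w₁ at *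
    generalize cramerNum x y a b c α β γ = w₂ at *
    have hD2 : (0 : ℝ) < (D : ℝ) * D := mul_self_pos.2 (by exact_mod_cast hD)
    have hB' : (0 : ℝ) < B := by exact_mod_cast hB
    rcases hOK with h | h | ⟨j, h⟩
    · exact absurd h hD
    · have h' : (B : ℝ) * (w₀ * w₀ + w₁ * w₁ + w₂ * w₂) ≤ A * (D * D) := by exact_mod_cast h
      rw [← h0, ← h1, ← h2] at h'
      refine (sq_le_sq₀ (norm_nonneg _) hR).1 ?_
      rw [EuclideanSpace.real_norm_sq_eq, Fin.sum_univ_three]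
      refine le_of_mul_le_mul_left ?_ (mul_pos hB' hD2)
      nlinarith [mul_le_mul_of_nonneg_right hAB hD2.le]
    · have h' : (n j : ℝ) * n j * (D * D) < (x j * w₀ + y j * w₁ + z j * w₂) ^ 2 := by
        exact_mod_cast h
      have hj := hvP j
      rw [hinner] at hj
      have hj2 := mul_le_mul_of_nonneg_right (sq_le_sq' (abs_le.1 hj).1 (abs_le.1 hj).2) hD2.le
      rw [← h0, ← h1, ← h2] at h'
      nlinarith

/-! ### Explicit directions for 10 to 16 facets -/

theorem polyDeltaSup_ten_three_le :
    polyDeltaSup 10 (convexBodies 3) ≤ ((1.438 : ℝ) : EReal) :=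
  polyDeltaSup_three_le_of_verticesOK (k := 5) le_rfl
    -- The columns of the first three rows are the directions, the fourth row bounds their lengths,
    -- and `A / B = 1.438²`.
    ![-1233, 1036, 429, 1221, 1043]
    ![-31, -1294, 1381, 72, 868]
    ![-1223, -518, -962, -1233, 1084]
    ![1737, 1737, 1737, 1737, 1737]
    (A := 516961) (B := 250000) (by norm_num) (by decide +kernel)
    (by decide +kernel) ⟨0, 1, 2, by decide +kernel⟩ (by decide +kernel) (by norm_num) (by norm_num)

theorem polyDeltaSup_twelve_three_le :
    polyDeltaSup 12 (convexBodies 3) ≤ ((1.2585 : ℝ) : EReal) :=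
  polyDeltaSup_three_le_of_verticesOK (k := 6) le_rfl
    ![-6327, 5349, 2108, 2741, 4325, -9324]
    ![2886, -7733, 8161, -906, 6938, -1598]
    ![-6690, -2170, -4698, -9208, 5127, 1904]
    ![9650, 9650, 9650, 9650, 9651, 9650]
    (A := 6335289) (B := 4000000) (by norm_num) (by decide +kernel)
    (by decide +kernel) ⟨0, 1, 2, by decide +kernel⟩ (by decide +kernel) (by norm_num) (by norm_num)

theorem polyDeltaSup_fourteen_three_le :
    polyDeltaSup 14 (convexBodies 3) ≤ ((1.2394 : ℝ) : EReal) :=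
  polyDeltaSup_three_le_of_verticesOK (k := 7) le_rfl
    ![-4481, 2344, 168, 2538, 1851, -6079, -4676]
    ![1963, -5573, 5424, 690, 3126, 1102, -4300]
    ![-4059, -1964, -3311, -5787, 5216, 1497, -236]
    ![6357, 6357, 6357, 6357, 6357, 6357, 6357]
    (A := 38402809) (B := 25000000) (by norm_num) (by decide +kernel)
    (by decide +kernel) ⟨0, 1, 2, by decide +kernel⟩ (by decide +kernel) (by norm_num) (by norm_num)

theorem polyDeltaSup_sixteen_three_le :
    polyDeltaSup 16 (convexBodies 3) ≤ ((1.1999 : ℝ) : EReal) :=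
  polyDeltaSup_three_le_of_verticesOK (k := 8) le_rfl
    ![10930, 4529, 2336, 240, -3597, -8801, 6421, -7120]
    ![1845, 5932, -9660, 453, -10432, 4196, -7237, -3914]
    ![-266, 8200, 4916, -11076, -1083, -5280, -5418, 7545]
    ![11088, 11088, 11088, 11088, 11088, 11088, 11089, 11088]
    (A := 143976001) (B := 100000000) (by norm_num) (by decide +kernel)
    (by decide +kernel) ⟨0, 1, 2, by decide +kernel⟩ (by decide +kernel) (by norm_num) (by norm_num)

theorem corollary5 :
    (polyDeltaSup 6 (convexBodies 3) ≤ ((1.773 : ℝ) : EReal) ∧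
      polyDeltaSup 8 (convexBodies 3) ≤ ((1.529 : ℝ) : EReal) ∧
      polyDeltaSup 10 (convexBodies 3) ≤ ((1.438 : ℝ) : EReal) ∧
      polyDeltaSup 12 (convexBodies 3) ≤ ((1.2585 : ℝ) : EReal) ∧
      polyDeltaSup 14 (convexBodies 3) ≤ ((1.2394 : ℝ) : EReal) ∧
      polyDeltaSup 16 (convexBodies 3) ≤ ((1.1999 : ℝ) : EReal)) ∧
    (∀ d : ℕ, 2 ≤ d →
      polyDeltaSup (2 * d) (convexBodies d) ≤ ((Real.sqrt (d : ℝ) : ℝ) : EReal)) ∧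
    (∀ d : ℕ, 3 ≤ d →
      polyDeltaSup (2 * d + 2) (convexBodies d) ≤
        ((Real.sqrt ((d : ℝ) - 2 / 3) : ℝ) : EReal)) := by
  refine ⟨⟨?_, ?_, polyDeltaSup_ten_three_le, polyDeltaSup_twelve_three_le,
    polyDeltaSup_fourteen_three_le, polyDeltaSup_sixteen_three_le⟩,
    fun d hd ↦ polyDeltaSup_two_mul_le_sqrt (by omega),
    fun d hd ↦ polyDeltaSup_two_mul_add_two_le_sqrt (by omega)⟩
  · refine (polyDeltaSup_two_mul_le_sqrt (d := 3) (by norm_num)).trans ?_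
    rw [EReal.coe_le_coe_iff, Real.sqrt_le_left (by norm_num)]
    norm_num
  · refine (polyDeltaSup_two_mul_add_two_le_sqrt (d := 3) (by norm_num)).trans ?_
    rw [EReal.coe_le_coe_iff, Real.sqrt_le_left (by norm_num)]
    norm_num
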